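/- A nondeterministic Büchi automaton (NBA) is a tuple $\mathcal A=(Q,\Sigma,\delta,q_I,F)$ with a finite state set $Q$, an initial state $q_I\in Q$, transitions $\delta\subseteq Q\times\Sigma\times Q$ and accepting states $F\subseteq Q$; $L(\mathcal A)\subseteq\Sigma^\omega$ is the set of infinite words that have a run from $q_I$ visiting some state of $F$ infinitely often. A dead end is a state without outgoing transition. **Buffered games.** Let $p,q\in Q$. Spoiler's pebble starts on $p$, Duplicator's on $q$, and a FIFO buffer is initially empty. In each round Spoiler moves his pebble along a transition of $\mathcal A$ and appends its letter to the buffer; if the buffer now holds $k$ letters, Duplicator removes the first $r$ letters and moves her pebble along a path of $\mathcal A$ reading them. In the *continuous* game she may choose any $r\in\{0,\dots,k\}$, in the *look-ahead* game only $r\in\{0,k\}$. Let $\rho=q_0q_1\dots$ and $\rho'=q_0'q_1'\dots$ be the sequences of states visited by Spoiler and Duplicator (with $q_0=p$, $q'_0=q$). If $\rho$ is finite (Spoiler has reached a dead end), Duplicator wins. If $\rho$ is infinite, Duplicator wins if and only if $\rho'$ is infinite and * (*delayed*) for every $i\ge 0$ with $q_i\in F$ there is $j\ge i$ with $q'_j\in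 F$, respectively * (*direct*) for every $i\ge 0$ with $q_i\in F$ also $q'_i\in F$. The delayed (direct) continuous (look-ahead) simulation of $\mathcal A$ is the relation on $Q$ that holds between $p$ and $q$ if Duplicator has a winning strategy in the corresponding game from $(p,q)$. **Quotienting and pruning.** Let $R$ be a relation on $Q$ and $\preceq$ the preorder generated by it ($\preceq$ is $R$ if $R$ is a preorder; look-ahead simulation need not be transitive). Let $p\approx q$ mean $p\preceq q$ and $q\preceq p$. The quotient $\mathcal A/R$ has as states the $\approx$-classes $[q]$, the initial state $[q_I]$, the transitions $([p],a,[q])$ for $(p,a,q)\in\delta$, and the accepting states $[q]$ for $q\in F$. The automaton $\mathsf{prune}(\mathcal A,R)$ is obtained from $\mathcal A$ by removing each transition $(p,a,q)\in\delta$ for which there is $(p,a,q')\in\delta$ with $q\preceq q'$ and $q'\not\preceq q$. The relation $R$ is good for quotienting $\mathcal A$ if $L(\mathcal A/R)=L(\mathcal A)$, and good for pruning $\mathcal A$ if $L(\mathsf{prune}(\mathcal A,R))=L(\mathcal A)$. **Proposition.** 1. Delayed continuous and delayed look-ahead simulation are good for quotienting every NBA without dead ends. 2. Neither of them is good for pruning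 in general: for each of the two there is an NBA (over a finite alphabet and without dead ends) for which it is not good for pruning. 3. Direct continuous and direct look-ahead simulation are good for quotienting every NBA without dead ends. 4. Direct continuous and direct look-ahead simulation are good for pruning every NBA. -/

import Mathlib

universe u v w

/-- A nondeterministic Büchi automaton over the alphabet `α` with state set `Q`.
Finiteness of `Q` is a separate hypothesis `[Finite Q]`. -/
structure NBA (α : Type u) (Q : Type v) where
  /-- the starting state -/
  init : Q
  /-- the transition relation: `trans p a q` means that `(p, a, q)` is a transition -/
  trans : Q → α → Q → Prop
  /-- the accepting states -/
  acc : Set Q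

namespace NBA

variable {α : Type u} {Q : Type v} {Q' : Type w}

/-- The automaton `A(q)`: the same automaton started in `q`. -/
def startAt (A : NBA α Q) (q : Q) : NBA α Q := { A with init := q }

/-- No state is a dead end: every state has an outgoing transition. -/
def NoDeadEnds (A : NBA α Q) : Prop := ∀ p, ∃ a q, A.trans p a q

/-- `A.IsPath p [a₁, …, aₙ] [q₁, …, qₙ]`: the sequence `p a₁ q₁ a₂ q₂ … aₙ qₙ` is a path of `A`. -/
def IsPath (A : NBA α Q) : Q → List α → List Q → Prop
  | _, [], [] => True
  | p, a :: x, q :: l => A.trans p a q ∧ A.IsPath q x l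
  | _, _, _ => False

/-- `ρ` is an infinite run of `A` on the infinite word `x`, from the starting state. -/
def IsRun (A : NBA α Q) (x : ℕ → α) (ρ : ℕ → Q) : Prop :=
  ρ 0 = A.init ∧ ∀ i, A.trans (ρ i) (x i) (ρ (i + 1))

/-- The sequence `ρ` visits some accepting state infinitely often. -/
def IsAccepting (A : NBA α Q) (ρ : ℕ → Q) : Prop :=
  ∃ q ∈ A.acc, ∀ n, ∃ i ≥ n, ρ i = q

/-- The language `L(A)` of infinite words. -/
def language (A : NBA α Q) : Set (ℕ → α) :=
  {x | ∃ ρ, A.IsRun x ρ ∧ A.IsAccepting ρ}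

/-- The two kinds of buffered games. -/
inductive BufferKind
  | continuous
  | lookAhead

/-- May Duplicator remove `r` letters in a round from a buffer that holds `k` letters? -/
def BufferKind.Allows : BufferKind → ℕ → ℕ → Prop
  | .continuous, r, k => r ≤ k
  | .lookAhead, r, k => r = 0 ∨ r = k

/-- The two winning conditions. -/
inductive WinCond
  | delayed
  | direct

/-- The winning condition on an infinite run `ρ` of Spoiler (accepting states `F`) and an infinite
run `ρ'` of Duplicator (accepting states `F'`). -/
def WinCond.Holds (F : Set Q) (F' : Set Q') (ρ : ℕ → Q) (ρ' : ℕ → Q') : WinCond → Prop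
  | .delayed => ∀ i, ρ i ∈ F → ∃ j ≥ i, ρ' j ∈ F'
  | .direct => ∀ i, ρ i ∈ F → ρ' i ∈ F'

/-- A strategy of Duplicator. The argument lists Spoiler's moves (letter and new state) up to and
including the current round; the value lists the states through which Duplicator moves her pebble in
the current round (the empty list if she skips her turn). -/
abbrev Strategy (α : Type u) (Q : Type v) (Q' : Type w) := List (α × Q) → List Q'

/-- The states that Duplicator has appended to her run when she has answered all of Spoiler's
moves in `h` by the strategy `S`. -/
def Strategy.response (S : Strategy α Q Q') (h : List (α × Q)) : List Q' :=
  (List.range h.length).flatMap fun i => S (h.take (i + 1))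

/-- The position of Duplicator's pebble after the rounds in `h`. -/
def Strategy.pebble (S : Strategy α Q Q') (B : NBA α Q') (h : List (α × Q)) : Q' :=
  (S.response h).getLastD B.init

/-- The buffer after the rounds in `h`, extended by the letter `a` that Spoiler plays next:
the letters played so far without those that Duplicator has already removed. -/
def Strategy.buffer (S : Strategy α Q Q') (h : List (α × Q)) (a : α) : List α :=
  (h.map Prod.fst ++ [a]).drop (S.response h).length

/-- The strategy `S` obeys the rules of the buffered game of kind `κ` on `A` (Spoiler) and `B`
(Duplicator). Against every sequence of moves of Spoiler along a path of `A`, the letters removed in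
the current round are a prefix of the buffer of an allowed length, and Duplicator's pebble moves in
`B` along a path that reads them. -/
def Strategy.IsLegal (S : Strategy α Q Q') (κ : BufferKind) (A : NBA α Q) (B : NBA α Q') : Prop :=
  ∀ (h : List (α × Q)) (a : α) (q : Q),
    A.IsPath A.init ((h ++ [(a, q)]).map Prod.fst) ((h ++ [(a, q)]).map Prod.snd) →
      κ.Allows (S (h ++ [(a, q)])).length (S.buffer h a).length ∧
      B.IsPath (S.pebble B h) ((S.buffer h a).take (S (h ++ [(a, q)])).length) (S (h ++ [(a, q)]))

/-- Spoiler's first `n` moves when his pebble follows the run `ρ` on the word `x`. -/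
def moves (x : ℕ → α) (ρ : ℕ → Q) (n : ℕ) : List (α × Q) :=
  (List.range n).map fun i => (x i, ρ (i + 1))

/-- Duplicator, following `S` against Spoiler's infinite run `ρ` on `x`, produces the infinite
run `ρ'`. (If she skips forever from some round on, there is no such `ρ'`.) -/
def Strategy.Produces (S : Strategy α Q Q') (B : NBA α Q') (x : ℕ → α) (ρ : ℕ → Q)
    (ρ' : ℕ → Q') : Prop :=
  ρ' 0 = B.init ∧ ∀ i, ∃ n, (S.response (moves x ρ n))[i]? = some (ρ' (i + 1))

/-- `S` is a winning strategy for Duplicator: it obeys the rules, and whenever Spoiler's run is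
infinite, then Duplicator's run is infinite and the pair of runs meets the winning condition.
(If Spoiler's run is finite, because he reaches a dead end, then Duplicator wins.) -/
def Strategy.IsWinning (S : Strategy α Q Q') (κ : BufferKind) (ω : WinCond)
    (A : NBA α Q) (B : NBA α Q') : Prop :=
  S.IsLegal κ A B ∧
    ∀ x ρ, A.IsRun x ρ → ∃ ρ', S.Produces B x ρ ρ' ∧ ω.Holds A.acc B.acc ρ ρ'

/-- `B` simulates `A` in the buffered game of kind `κ` with winning condition `ω`. -/
def BufferedSim (κ : BufferKind) (ω : WinCond) (A : NBA α Q) (B : NBA α Q') : Prop :=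
  ∃ S : Strategy α Q Q', S.IsWinning κ ω A B

/-- Buffered simulation as a relation on the states of `A`: `q` simulates `p`. -/
def sim (A : NBA α Q) (κ : BufferKind) (ω : WinCond) (p q : Q) : Prop :=
  BufferedSim κ ω (A.startAt p) (A.startAt q)

/-- The preorder generated by a relation. It is the relation itself when that is a preorder. It is
needed since look-ahead simulation is not transitive in general. -/
def generatedPreorder (R : Q → Q → Prop) : Q → Q → Prop := Relation.ReflTransGen R

/-- The equivalence relation induced by the preorder generated by `R`. -/
def equivalence (R : Q → Q → Prop) : Setoid Q where
  r p q := generatedPreorder R p q ∧ generatedPreorder R q p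
  iseqv :=
    ⟨fun _ => ⟨Relation.ReflTransGen.refl, Relation.ReflTransGen.refl⟩,
      fun h => ⟨h.2, h.1⟩, fun h k => ⟨h.1.trans k.1, k.2.trans h.2⟩⟩

/-- The quotient automaton `A/R`: equivalent states are merged; a transition between two classes,
and acceptance of a class, are inherited from the members. -/
def quotient (A : NBA α Q) (R : Q → Q → Prop) : NBA α (Quotient (equivalence R)) where
  init := Quotient.mk _ A.init
  trans c a d := ∃ p q, Quotient.mk _ p = c ∧ Quotient.mk _ q = d ∧ A.trans p a q
  acc := {c | ∃ q ∈ A.acc, Quotient.mk _ q = c}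

/-- The pruned automaton `prune(A, R)`: a transition `(p, a, q)` is removed if there is a
transition `(p, a, q')` such that `q` is strictly below `q'` in the preorder. -/
def prune (A : NBA α Q) (R : Q → Q → Prop) : NBA α Q where
  init := A.init
  trans p a q := A.trans p a q ∧
    ¬ ∃ q', A.trans p a q' ∧ generatedPreorder R q q' ∧ ¬ generatedPreorder R q' q
  acc := A.acc

/-- `R` is good for quotienting `A`. -/
def GoodForQuotienting (A : NBA α Q) (R : Q → Q → Prop) : Prop :=
  (A.quotient R).language = A.language

/-- `R` is good for pruning `A`. -/
def GoodForPruning (A : NBA α Q) (R : Q → Q → Prop) : Prop :=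
  (A.prune R).language = A.language

end NBA

/-!
**Quotienting.** Equip the finite state set with the discrete topology. For a fixed infinite word,
the runs from a state then form a compact space of sequences, and a winning strategy of Duplicator
induces a *continuous* map from the runs of `p` to the runs of `q`, because every state of
Duplicator's run depends on finitely many moves of Spoiler (`delayedContinuousIncl_of_sim`). This
is all that is used of a simulation, so all four kinds are treated at once, and the maps compose, so
passing to the generated preorder is harmless.

An accepting run of the quotient on `x` consists of transitions `p i -x i-> q i` of the automaton
with `q i` equivalent to `p (i + 1)`. A run from `p (i + 1)` on the `(i + 1)`-st suffix of `x` is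
mapped to a run from `q i`, and prefixing `p i` gives a run from `p i` on the `i`-th suffix. This is
an inverse sequence of compact spaces, which are nonempty by König's lemma
(`runs_nonempty_of_prefixes`; absence of dead ends enters here). Hence there are runs
`r i` such that each `r i` is exactly the image of `r (i + 1)` (`exists_coherent_sequence`). The map
at an accepting class can be made to factor through the runs of an accepting state, and the maps
never lose an accepting visit or move it to an earlier time, so `r 0` visits accepting states
infinitely often. Continuity is essential: delayed trace inclusion alone is not good for quotienting.

**Pruning.** Direct simulation implies direct trace inclusion. In an accepting run, replace the
transitions one after the other by transitions to maximal successors, continuing each time with a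
run given by trace inclusion (`exists_run_trans_prune`). The prefix already treated stays fixed and
no accepting position is lost, so the diagonal run is accepting and uses no pruned transition.

For delayed simulation, two states suffice for a counterexample (`pruningCounterexample`): the only
transition from the initial to the accepting state is pruned in favour of a loop from which it could
still be taken later, and it can be put off forever.
-/

open Topology

namespace NBA

variable {α : Type u} {Q : Type v} {Q' : Type w}

/-! ### Paths and responses -/

lemma IsPath.append {A : NBA α Q} {p : Q} {x y : List α} {l m : List Q}
    (h : A.IsPath p x l) (h' : A.IsPath (l.getLastD p) y m) : A.IsPath p (x ++ y) (l ++ m) := by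
  induction l generalizing p x with
  | nil =>
    cases x with
    | nil => simpa using h'
    | cons a x => exact h.elim
  | cons q l ih =>
    cases x with
    | nil => exact h.elim
    | cons a x => exact ⟨h.1, ih h.2 (by simpa only [List.getLastD_cons] using h')⟩

lemma IsPath.trans_getElem {A : NBA α Q} {p : Q} {x : List α} {l : List Q}
    (h : A.IsPath p x l) {i : ℕ} {q : Q} (hq : l[i]? = some q) :
    ∃ a p', x[i]? = some a ∧ (p :: l)[i]? = some p' ∧ A.trans p' a q := by
  induction l generalizing p x i with
  | nil => simp at hq
  | cons r l ih =>
    cases x with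
    | nil => exact h.elim
    | cons a x =>
      cases i with
      | zero =>
        obtain rfl : r = q := by simpa using hq
        exact ⟨a, p, by simp, by simp, h.1⟩
      | succ i =>
        obtain ⟨b, p', hb, hp', ht⟩ := ih h.2 (by simpa using hq)
        exact ⟨b, p', by simpa using hb, by simpa using hp', ht⟩

lemma Strategy.response_concat (S : Strategy α Q Q') (h : List (α × Q)) (m : α × Q) :
    S.response (h ++ [m]) = S.response h ++ S (h ++ [m]) := by
  unfold Strategy.response
  rw [List.length_append, List.length_singleton, List.range_succ, List.flatMap_append]
  congr 1
  · refine List.flatMap_congr fun i hi => ?_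
    rw [List.take_append_of_le_length (List.mem_range.1 hi)]
  · simp [List.take_of_length_le]

lemma moves_succ (x : ℕ → α) (ρ : ℕ → Q) (n : ℕ) :
    moves x ρ (n + 1) = moves x ρ n ++ [(x n, ρ (n + 1))] := by
  simp [moves, List.range_succ]

lemma length_moves (x : ℕ → α) (ρ : ℕ → Q) (n : ℕ) : (moves x ρ n).length = n := by
  simp [moves]

lemma getLastD_moves {A : NBA α Q} {x : ℕ → α} {ρ : ℕ → Q} (h : A.IsRun x ρ) (n : ℕ) :
    ((moves x ρ n).map Prod.snd).getLastD A.init = ρ n := by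
  cases n with
  | zero => simp [moves, h.1]
  | succ n => simp [moves_succ]

lemma IsRun.isPath_moves {A : NBA α Q} {x : ℕ → α} {ρ : ℕ → Q} (h : A.IsRun x ρ) (n : ℕ) :
    A.IsPath A.init ((moves x ρ n).map Prod.fst) ((moves x ρ n).map Prod.snd) := by
  induction n with
  | zero => simp [moves, IsPath]
  | succ n ih =>
    rw [moves_succ, List.map_append, List.map_append]
    refine ih.append ?_
    rw [getLastD_moves h]
    exact ⟨h.2 n, trivial⟩

lemma BufferKind.Allows.le {κ : BufferKind} {r k : ℕ} (h : κ.Allows r k) : r ≤ k := by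
  cases κ with
  | continuous => exact h
  | lookAhead => rcases h with h | h <;> omega

/-- Along a run of Spoiler, the responses of a legal strategy form a path of Duplicator that reads
a prefix of Spoiler's word. -/
lemma Strategy.IsLegal.isPath_response {S : Strategy α Q Q'} {κ : BufferKind} {A : NBA α Q}
    {B : NBA α Q'} (hS : S.IsLegal κ A B) {x : ℕ → α} {ρ : ℕ → Q} (h : A.IsRun x ρ) (n : ℕ) :
    (S.response (moves x ρ n)).length ≤ n ∧
      B.IsPath B.init
        (((moves x ρ n).map Prod.fst).take (S.response (moves x ρ n)).length)
        (S.response (moves x ρ n)) := by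
  induction n with
  | zero => simp [moves, Strategy.response, IsPath]
  | succ n ih =>
    obtain ⟨hle, hpath⟩ := ih
    have hp := h.isPath_moves (n + 1)
    rw [moves_succ] at hp
    obtain ⟨hal, hstep⟩ := hS _ _ _ hp
    have hal' := hal.le
    simp only [Strategy.buffer, List.length_drop, List.length_append, List.length_map,
      length_moves, List.length_singleton] at hal'
    rw [moves_succ, Strategy.response_concat, List.length_append, List.take_add]
    refine ⟨by omega, IsPath.append ?_ ?_⟩
    · rwa [List.map_append, List.take_append_of_le_length (by simpa [length_moves] using hle)]
    · simpa [Strategy.buffer, Strategy.pebble] using hstep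

lemma getElem?_of_prefix {X : Type*} {l m : List X} (h : l <+: m) {i : ℕ} {a : X}
    (ha : l[i]? = some a) : m[i]? = some a := by
  obtain ⟨t, rfl⟩ := h
  obtain ⟨hi, -⟩ := List.getElem?_eq_some_iff.1 ha
  rwa [List.getElem?_append_left hi]

lemma Strategy.response_moves_prefix (S : Strategy α Q Q') (x : ℕ → α) (ρ : ℕ → Q) {m n : ℕ}
    (h : m ≤ n) : S.response (moves x ρ m) <+: S.response (moves x ρ n) := by
  induction n, h using Nat.le_induction with
  | base => exact List.prefix_rfl
  | succ n _ ih =>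
    rw [moves_succ, Strategy.response_concat]
    exact ih.trans (List.prefix_append _ _)

lemma Strategy.Produces.eq_of_getElem {S : Strategy α Q Q'} {B : NBA α Q'} {x : ℕ → α}
    {ρ : ℕ → Q} {ρ' : ℕ → Q'} (h : S.Produces B x ρ ρ') {n i : ℕ} {q : Q'}
    (hq : (S.response (moves x ρ n))[i]? = some q) : ρ' (i + 1) = q := by
  obtain ⟨m, hm⟩ := h.2 i
  have h1 := getElem?_of_prefix (S.response_moves_prefix x ρ (le_max_left m n)) hm
  have h2 := getElem?_of_prefix (S.response_moves_prefix x ρ (le_max_right m n)) hq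
  exact Option.some.inj (h1.symm.trans h2)

lemma Strategy.Produces.isRun {S : Strategy α Q Q'} {κ : BufferKind} {A : NBA α Q}
    {B : NBA α Q'} (hS : S.IsLegal κ A B) {x : ℕ → α} {ρ : ℕ → Q} {ρ' : ℕ → Q'}
    (hρ : A.IsRun x ρ) (h : S.Produces B x ρ ρ') : B.IsRun x ρ' := by
  refine ⟨h.1, fun i => ?_⟩
  obtain ⟨n, hn⟩ := h.2 i
  obtain ⟨a, p, ha, hp, ht⟩ := (hS.isPath_response hρ n).2.trans_getElem hn
  have hax : a = x i := by
    have ha' := getElem?_of_prefix (List.take_prefix _ _) ha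
    simp only [moves, List.map_map, List.getElem?_map, Option.map_eq_some_iff] at ha'
    obtain ⟨k, hk, rfl⟩ := ha'
    obtain ⟨_, rfl⟩ := List.getElem?_eq_some_iff.1 hk
    simp
  have hpx : p = ρ' i := by
    cases i with
    | zero => simpa [h.1, eq_comm] using hp
    | succ i => exact (h.eq_of_getElem (by simpa using hp)).symm
  rwa [hax, hpx] at ht

/-! ### Spaces of runs -/

/-- The infinite runs of `A` on the word `x`, as a subspace of the space of sequences of states. -/
def runs (A : NBA α Q) (x : ℕ → α) : Set (ℕ → Q) := {ρ | A.IsRun x ρ}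

lemma isClosed_setOf_trans [TopologicalSpace Q] [DiscreteTopology Q] (A : NBA α Q) (a : α)
    (k : ℕ) : IsClosed {ρ : ℕ → Q | A.trans (ρ k) a (ρ (k + 1))} := by
  have hc : Continuous fun ρ : ℕ → Q => (ρ k, ρ (k + 1)) := by fun_prop
  exact (isClosed_discrete {t : Q × Q | A.trans t.1 a t.2}).preimage hc

lemma isClosed_setOf_zero_eq [TopologicalSpace Q] [DiscreteTopology Q] (p : Q) :
    IsClosed {ρ : ℕ → Q | ρ 0 = p} :=
  isClosed_eq (continuous_apply 0) continuous_const

instance compactSpace_runs [Finite Q] [TopologicalSpace Q] [DiscreteTopology Q] (A : NBA α Q)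
    (x : ℕ → α) : CompactSpace (A.runs x) := by
  have h : IsClosed (A.runs x) := by
    simp only [runs, IsRun, Set.ofPred_and, Set.ofPred_forall]
    exact (isClosed_setOf_zero_eq _).inter (isClosed_iInter fun k => A.isClosed_setOf_trans _ k)
  exact isCompact_iff_compactSpace.1 h.isCompact

/-- **König's lemma** for runs: over a finite state set there is a run on `x` if every finite
prefix of `x` is a prefix of a word that has a run. -/
lemma runs_nonempty_of_prefixes [Finite Q] (A : NBA α Q) (x : ℕ → α)
    (h : ∀ n, ∃ y, (∀ k < n, y k = x k) ∧ (A.runs y).Nonempty) : (A.runs x).Nonempty := by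
  let _ : TopologicalSpace Q := ⊥
  have : DiscreteTopology Q := ⟨rfl⟩
  let D : ℕ → Set (ℕ → Q) := fun n =>
    {ρ | ρ 0 = A.init} ∩ ⋂ k, ⋂ _ : k < n, {ρ | A.trans (ρ k) (x k) (ρ (k + 1))}
  have hcl : ∀ n, IsClosed (D n) := fun n => (isClosed_setOf_zero_eq _).inter
    (isClosed_iInter fun k => isClosed_iInter fun _ => A.isClosed_setOf_trans _ k)
  obtain ⟨ρ, hρ⟩ := IsCompact.nonempty_iInter_of_sequence_nonempty_isCompact_isClosed D
    (fun n ρ hρ => ⟨hρ.1, by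
      have := hρ.2
      simp only [Set.mem_iInter] at this ⊢
      exact fun k hk => this k (by omega)⟩)
    (fun n => by
      obtain ⟨y, hy, ρ, hρ⟩ := h n
      refine ⟨ρ, hρ.1, ?_⟩
      simp only [Set.mem_iInter]
      intro k hk
      have := hρ.2 k
      rwa [hy k hk] at this)
    (hcl 0).isCompact hcl
  simp only [D, Set.mem_iInter, Set.mem_inter_iff] at hρ
  exact ⟨ρ, (hρ 0).1, fun k => (hρ (k + 1)).2 k (by omega)⟩

/-- An inverse sequence of nonempty compact Hausdorff spaces has a coherent sequence of points. -/
lemma exists_coherent_sequence {X : ℕ → Type*} [∀ i, TopologicalSpace (X i)]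
    [∀ i, CompactSpace (X i)] [∀ i, T2Space (X i)] [∀ i, Nonempty (X i)]
    (f : ∀ i, X (i + 1) → X i) (hf : ∀ i, Continuous (f i)) :
    ∃ r : ∀ i, X i, ∀ i, r i = f i (r (i + 1)) := by
  let D : ℕ → Set (∀ i, X i) := fun n => ⋂ i, ⋂ _ : i < n, {r | r i = f i (r (i + 1))}
  have hcl : ∀ n, IsClosed (D n) := fun n => isClosed_iInter fun i => isClosed_iInter fun _ =>
    isClosed_eq (continuous_apply i) ((hf i).comp (continuous_apply (i + 1)))
  have hne : ∀ n, ∀ z : ∀ i, X i, ∃ r ∈ D n, ∀ i, n ≤ i → r i = z i := by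
    intro n
    induction n with
    | zero => exact fun z => ⟨z, by simp [D], fun _ _ => rfl⟩
    | succ n ih =>
      intro z
      obtain ⟨r, hr, hrz⟩ := ih (Function.update z n (f n (z (n + 1))))
      simp only [D, Set.mem_iInter] at hr
      have hz : ∀ i, n + 1 ≤ i → r i = z i := fun i hi => by
        rw [hrz i (by omega), Function.update_of_ne (by omega)]
      refine ⟨r, ?_, hz⟩
      simp only [D, Set.mem_iInter]
      intro i hi
      rcases Nat.lt_succ_iff_lt_or_eq.1 hi with hi | rfl
      · exact hr i hi
      · change r i = f i (r (i + 1))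
        rw [hrz i le_rfl, Function.update_self, hz (i + 1) le_rfl]
  obtain ⟨r, hr⟩ := IsCompact.nonempty_iInter_of_sequence_nonempty_isCompact_isClosed D
    (fun n r hr => by
      simp only [D, Set.mem_iInter] at hr ⊢
      exact fun i hi => hr i (by omega))
    (fun n => (hne n fun i => Classical.arbitrary _).imp fun r hr => hr.1)
    (hcl 0).isCompact hcl
  simp only [D, Set.mem_iInter] at hr
  exact ⟨r, fun i => hr (i + 1) i (by omega)⟩

/-- The sequence `ρ` with `p` put in front. -/
def consSeq {X : Type*} (p : X) (ρ : ℕ → X) : ℕ → X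
  | 0 => p
  | k + 1 => ρ k

lemma consSeq_mem_runs {A : NBA α Q} {p q : Q} {x : ℕ → α} {ρ : ℕ → Q}
    (h : A.trans p (x 0) q) (hρ : ρ ∈ (A.startAt q).runs fun k => x (k + 1)) :
    consSeq p ρ ∈ (A.startAt p).runs x := by
  refine ⟨rfl, fun k => ?_⟩
  cases k with
  | zero =>
    have h0 : ρ 0 = q := hρ.1
    change A.trans p (x 0) (ρ 0)
    rwa [h0]
  | succ k => exact hρ.2 k

lemma continuous_consSeq {X : Type*} [TopologicalSpace X] (p : X) : Continuous (consSeq p) := by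
  refine continuous_pi fun k => ?_
  cases k with
  | zero => exact continuous_const
  | succ k => exact continuous_apply k

lemma NoDeadEnds.exists_run {A : NBA α Q} (hA : A.NoDeadEnds) (p : Q) :
    ∃ x, ((A.startAt p).runs x).Nonempty := by
  choose a s hs using hA
  exact ⟨fun n => a (s^[n] p), fun n => s^[n] p, rfl, fun n => by
    change A.trans (s^[n] p) (a (s^[n] p)) (s^[n + 1] p)
    rw [Function.iterate_succ_apply']
    exact hs _⟩

lemma isAccepting_of_frequently [Finite Q] {A : NBA α Q} {ρ : ℕ → Q}
    (h : ∀ n, ∃ i ≥ n, ρ i ∈ A.acc) : A.IsAccepting ρ := by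
  by_contra hcon
  have hb : ∀ q, ∃ n, q ∈ A.acc → ∀ i ≥ n, ρ i ≠ q := fun q => by
    by_contra! hq
    exact hcon ⟨q, (hq 0).1, fun n => (hq n).2⟩
  choose b hb using hb
  obtain ⟨M, hM⟩ := Finite.exists_le b
  obtain ⟨i, hi, hacc⟩ := h M
  exact hb (ρ i) hacc i ((hM _).trans hi) rfl

lemma IsAccepting.frequently {A : NBA α Q} {ρ : ℕ → Q} (h : A.IsAccepting ρ) (n : ℕ) :
    ∃ i ≥ n, ρ i ∈ A.acc := by
  obtain ⟨q, hq, hi⟩ := h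
  obtain ⟨i, hn, rfl⟩ := hi n
  exact ⟨i, hn, hq⟩

/-! ### Consequences of buffered simulation on a fixed word -/

/-- On each word, the runs from `p` can be mapped continuously to runs from `q` in such a way that
every accepting state of the given run is followed by one of its image. Continuity says that
each state of the image depends on a finite prefix of the given run only. -/
def DelayedContinuousIncl [TopologicalSpace Q] (A : NBA α Q) (p q : Q) : Prop :=
  ∀ x, ∃ Φ : (A.startAt p).runs x → (A.startAt q).runs x, Continuous Φ ∧
    ∀ ρ i, ρ.1 i ∈ A.acc → ∃ j ≥ i, (Φ ρ).1 j ∈ A.acc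

/-- Direct trace inclusion: each run from `p` is matched by a run from `q` on the same word that is
in an accepting state whenever the given one is. -/
def DirectTraceIncl (A : NBA α Q) (p q : Q) : Prop :=
  ∀ x, ∀ ρ ∈ (A.startAt p).runs x, ∃ ρ' ∈ (A.startAt q).runs x, ∀ i, ρ i ∈ A.acc → ρ' i ∈ A.acc

lemma WinCond.Holds.delayed {F : Set Q} {F' : Set Q'} {ρ : ℕ → Q} {ρ' : ℕ → Q'} {ω : WinCond}
    (h : ω.Holds F F' ρ ρ') : WinCond.delayed.Holds F F' ρ ρ' := by
  cases ω with
  | delayed => exact h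
  | direct => exact fun i hi => ⟨i, le_rfl, h i hi⟩

/-- Since Duplicator's moves depend on finitely many of Spoiler's moves, and since on a fixed word
these are determined by finitely many states, a winning strategy induces a continuous map. -/
lemma delayedContinuousIncl_of_sim [TopologicalSpace Q] [DiscreteTopology Q] {A : NBA α Q}
    {κ : BufferKind} {ω : WinCond} {p q : Q} (h : A.sim κ ω p q) :
    A.DelayedContinuousIncl p q := by
  intro x
  obtain ⟨S, hleg, hwin⟩ := h
  choose Φ hΦ hω using fun ρ : (A.startAt p).runs x => hwin x ρ.1 ρ.2
  refine ⟨fun ρ => ⟨Φ ρ, (hΦ ρ).isRun hleg ρ.2⟩, ?_, fun ρ i hi => (hω ρ).delayed i hi⟩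
  refine Continuous.subtype_mk (continuous_pi fun i => ?_) _
  cases i with
  | zero => simpa only [(hΦ _).1] using continuous_const
  | succ i =>
    refine continuous_iff_continuousAt.2 fun ρ => ?_
    obtain ⟨n, hn⟩ := (hΦ ρ).2 i
    have hev : ∀ᶠ ρ₂ : (A.startAt p).runs x in 𝓝 ρ, ∀ k ∈ Finset.range n,
        ρ₂.1 (k + 1) = ρ.1 (k + 1) := by
      refine (Filter.eventually_all_finset _).2 fun k _ => ?_
      have hc : Continuous fun ρ₂ : (A.startAt p).runs x => ρ₂.1 (k + 1) :=
        (continuous_apply (k + 1)).comp continuous_subtype_val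
      exact hc.continuousAt.eventually ((isOpen_discrete {ρ.1 (k + 1)}).mem_nhds rfl)
    refine continuousAt_const.congr (f := fun _ => Φ ρ (i + 1)) ?_
    filter_upwards [hev] with ρ₂ h₂
    have hm : moves x ρ₂.1 n = moves x ρ.1 n :=
      List.map_congr_left fun k hk => by rw [h₂ k (by simpa using hk)]
    exact ((hΦ ρ₂).eq_of_getElem (hm ▸ hn)).symm

lemma directTraceIncl_of_sim {A : NBA α Q} {κ : BufferKind} {p q : Q}
    (h : A.sim κ .direct p q) : A.DirectTraceIncl p q := by
  intro x ρ hρ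
  obtain ⟨S, hleg, hwin⟩ := h
  obtain ⟨ρ', hρ', hω⟩ := hwin x ρ hρ
  exact ⟨ρ', hρ'.isRun hleg hρ, hω⟩

lemma delayedContinuousIncl_of_generatedPreorder [TopologicalSpace Q] {A : NBA α Q}
    {R : Q → Q → Prop} (hR : ∀ p q, R p q → A.DelayedContinuousIncl p q) {p q : Q}
    (h : generatedPreorder R p q) : A.DelayedContinuousIncl p q := by
  induction h with
  | refl => exact fun x => ⟨id, continuous_id, fun ρ i hi => ⟨i, le_rfl, hi⟩⟩
  | tail _ hbc ih =>
    intro x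
    obtain ⟨Φ, hΦ, hacc⟩ := ih x
    obtain ⟨Ψ, hΨ, hacc'⟩ := hR _ _ hbc x
    refine ⟨Ψ ∘ Φ, hΨ.comp hΦ, fun ρ i hi => ?_⟩
    obtain ⟨j, hj, hj'⟩ := hacc ρ i hi
    obtain ⟨k, hk, hk'⟩ := hacc' (Φ ρ) j hj'
    exact ⟨k, hj.trans hk, hk'⟩

lemma directTraceIncl_of_generatedPreorder {A : NBA α Q} {R : Q → Q → Prop}
    (hR : ∀ p q, R p q → A.DirectTraceIncl p q) {p q : Q} (h : generatedPreorder R p q) :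
    A.DirectTraceIncl p q := by
  induction h with
  | refl => exact fun x ρ hρ => ⟨ρ, hρ, fun _ hi => hi⟩
  | tail _ hbc ih =>
    intro x ρ hρ
    obtain ⟨σ, hσ, hacc⟩ := ih x ρ hρ
    obtain ⟨τ, hτ, hacc'⟩ := hR _ _ hbc x σ hσ
    exact ⟨τ, hτ, fun i hi => hacc' i (hacc i hi)⟩

/-! ### Quotients -/

lemma language_subset_language_quotient (A : NBA α Q) (R : Q → Q → Prop) :
    A.language ⊆ (A.quotient R).language := by
  rintro x ⟨ρ, ⟨h0, hs⟩, q, hq, hi⟩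
  refine ⟨fun i => Quotient.mk _ (ρ i), ⟨congrArg _ h0, fun i => ⟨_, _, rfl, rfl, hs i⟩⟩,
    Quotient.mk _ q, ⟨q, hq, rfl⟩, fun n => ?_⟩
  obtain ⟨i, hn, hi⟩ := hi n
  exact ⟨i, hn, congrArg _ hi⟩

/-- Between equivalent states, the continuous map can be chosen to factor through any
state of the class, so that its values visit an accepting state if the class has one. -/
lemma exists_continuous_map_of_equivalent [TopologicalSpace Q] {A : NBA α Q} {R : Q → Q → Prop}
    (hR : ∀ p q, R p q → A.DelayedContinuousIncl p q) {p q : Q}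
    (h : (Quotient.mk (equivalence R) p) = Quotient.mk (equivalence R) q) (x : ℕ → α) :
    ∃ Φ : (A.startAt p).runs x → (A.startAt q).runs x, Continuous Φ ∧
      (∀ ρ i, ρ.1 i ∈ A.acc → ∃ j ≥ i, (Φ ρ).1 j ∈ A.acc) ∧
      (Quotient.mk (equivalence R) p ∈ (A.quotient R).acc → ∀ ρ, ∃ j, (Φ ρ).1 j ∈ A.acc) := by
  by_cases hacc : Quotient.mk (equivalence R) p ∈ (A.quotient R).acc
  · obtain ⟨f, hf, hfp⟩ := hacc
    obtain ⟨Φ, hΦ, hΦa⟩ :=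
      delayedContinuousIncl_of_generatedPreorder hR (Quotient.exact hfp).2 x
    obtain ⟨Ψ, hΨ, hΨa⟩ :=
      delayedContinuousIncl_of_generatedPreorder hR (Quotient.exact (hfp.trans h)).1 x
    refine ⟨Ψ ∘ Φ, hΨ.comp hΦ, fun ρ i hi => ?_, fun _ ρ => ?_⟩
    · obtain ⟨j, hj, hj'⟩ := hΦa ρ i hi
      obtain ⟨k, hk, hk'⟩ := hΨa (Φ ρ) j hj'
      exact ⟨k, hj.trans hk, hk'⟩
    · have h0 : (Φ ρ).1 0 = f := (Φ ρ).2.1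
      obtain ⟨k, -, hk⟩ := hΨa (Φ ρ) 0 (by rwa [h0])
      exact ⟨k, hk⟩
  · obtain ⟨Φ, hΦ, hΦa⟩ := delayedContinuousIncl_of_generatedPreorder hR (Quotient.exact h).1 x
    exact ⟨Φ, hΦ, hΦa, fun h' => absurd h' hacc⟩

theorem goodForQuotienting_of_delayedContinuousIncl [Finite Q] [TopologicalSpace Q]
    [DiscreteTopology Q] {A : NBA α Q} (hA : A.NoDeadEnds) {R : Q → Q → Prop}
    (hR : ∀ p q, R p q → A.DelayedContinuousIncl p q) : A.GoodForQuotienting R := by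
  refine Set.Subset.antisymm ?_ (A.language_subset_language_quotient R)
  rintro x ⟨c, ⟨hc0, hcs⟩, hcacc⟩
  choose p q hp hq ht using hcs
  have hqp : ∀ i, Quotient.mk (equivalence R) (p (i + 1)) = Quotient.mk _ (q i) := fun i =>
    (hp (i + 1)).trans (hq i).symm
  have hshift : ∀ i, (fun k => x (i + (k + 1))) = fun k => x (i + 1 + k) := fun i => by
    funext k; congr 1; omega
  -- Finite prefixes: the runs needed here read the prefix and then any letters whatsoever.
  have hprefix : ∀ n i, ∃ y, (∀ k < n, y k = x (i + k)) ∧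
      ((A.startAt (p i)).runs y).Nonempty := by
    intro n
    induction n with
    | zero =>
      intro i
      obtain ⟨y, hy⟩ := hA.exists_run (p i)
      exact ⟨y, by simp, hy⟩
    | succ n ih =>
      intro i
      obtain ⟨y, hy, ρ, hρ⟩ := ih (i + 1)
      obtain ⟨Φ, -⟩ := exists_continuous_map_of_equivalent hR (hqp i) y
      refine ⟨consSeq (x i) y, fun k hk => ?_, consSeq (p i) (Φ ⟨ρ, hρ⟩).1,
        consSeq_mem_runs (ht i) (Φ ⟨ρ, hρ⟩).2⟩
      cases k with
      | zero => rfl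
      | succ k =>
        rw [consSeq, hy k (by omega)]
        congr 1; omega
  have : ∀ i, Nonempty ((A.startAt (p i)).runs fun k => x (i + k)) := fun i =>
    (runs_nonempty_of_prefixes _ _ fun n => hprefix n i).to_subtype
  choose Φ hΦ hΦdel hΦacc using fun i =>
    exists_continuous_map_of_equivalent hR (hqp i) fun k => x (i + 1 + k)
  obtain ⟨r, hr⟩ := exists_coherent_sequence
    (X := fun i => (A.startAt (p i)).runs fun k => x (i + k))
    (fun i ρ => ⟨consSeq (p i) (Φ i ρ).1,
      consSeq_mem_runs (ht i) (by rw [hshift]; exact (Φ i ρ).2)⟩)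
    (fun i => ((continuous_consSeq _).comp
      (continuous_subtype_val.comp (hΦ i))).subtype_mk _)
  have hr' : ∀ i k, (r i).1 (k + 1) = (Φ i (r (i + 1))).1 k := fun i k => by
    conv_lhs => rw [hr i]
    rfl
  -- An accepting class at time `i + 1` makes `r m` accepting at some time `≥ i` if `m ≤ i`.
  have hvisit : ∀ i, c (i + 1) ∈ (A.quotient R).acc → ∀ d m, m + d = i →
      ∃ k, i ≤ m + k ∧ (r m).1 k ∈ A.acc := by
    intro i hi d
    induction d with
    | zero =>
      rintro m rfl
      obtain ⟨j, hj⟩ := hΦacc m (by rw [hp (m + 1)]; exact hi) (r (m + 1))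
      exact ⟨j + 1, by omega, by rwa [hr']⟩
    | succ d ih =>
      intro m hm
      obtain ⟨k, hk, hk'⟩ := ih (m + 1) (by omega)
      obtain ⟨j, hj, hj'⟩ := hΦdel m _ k hk'
      exact ⟨j + 1, by omega, by rwa [hr']⟩
  have hinit : Quotient.mk (equivalence R) (p 0) = Quotient.mk _ A.init := (hp 0).trans hc0
  obtain ⟨Ψ, -, hΨdel, -⟩ := exists_continuous_map_of_equivalent hR hinit fun k => x (0 + k)
  refine ⟨(Ψ (r 0)).1, ?_, isAccepting_of_frequently fun n => ?_⟩
  · have := (Ψ (r 0)).2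
    simp only [zero_add] at this
    exact this
  · obtain ⟨i, hi, hacc⟩ := hcacc.frequently (n + 1)
    obtain ⟨i, rfl⟩ : ∃ i', i = i' + 1 := ⟨i - 1, by omega⟩
    obtain ⟨k, hk, hk'⟩ := hvisit i hacc i 0 (by omega)
    obtain ⟨j, hj, hj'⟩ := hΨdel _ k hk'
    exact ⟨j, by omega, hj'⟩

/-! ### Pruning -/

lemma language_prune_subset (A : NBA α Q) (R : Q → Q → Prop) :
    (A.prune R).language ⊆ A.language := by
  rintro x ⟨ρ, ⟨h0, hs⟩, hacc⟩
  exact ⟨ρ, ⟨h0, fun i => (hs i).1⟩, hacc⟩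

/-- The `n`-th transition of a run can be replaced by one that is not pruned: pass to a maximal
successor and continue by trace inclusion. -/
lemma exists_run_trans_prune [Finite Q] {A : NBA α Q} {R : Q → Q → Prop}
    (hR : ∀ p q, R p q → A.DirectTraceIncl p q) {x : ℕ → α} {ρ : ℕ → Q} (hρ : A.IsRun x ρ)
    (n : ℕ) : ∃ ρ', A.IsRun x ρ' ∧ (∀ k ≤ n, ρ' k = ρ k) ∧
      (A.prune R).trans (ρ' n) (x n) (ρ' (n + 1)) ∧ ∀ i, ρ i ∈ A.acc → ρ' i ∈ A.acc := by
  let _ : Preorder Q :=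
    { le := generatedPreorder R
      le_refl := fun _ => Relation.ReflTransGen.refl
      le_trans := fun _ _ _ => Relation.ReflTransGen.trans }
  obtain ⟨q, ⟨hq, hle⟩, hmax⟩ := (Set.toFinite
    {q | A.trans (ρ n) (x n) q ∧ ρ (n + 1) ≤ q}).exists_maximal ⟨_, hρ.2 n, le_rfl⟩
  obtain ⟨τ, ⟨hτ0, hτ⟩, hacc⟩ := directTraceIncl_of_generatedPreorder hR hle
    (fun k => x (n + 1 + k)) (fun k => ρ (n + 1 + k)) ⟨rfl, fun k => hρ.2 (n + 1 + k)⟩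
  change τ 0 = q at hτ0
  have hlow : ∀ k ≤ n, (if k ≤ n then ρ k else τ (k - (n + 1))) = ρ k := fun k hk => if_pos hk
  have hhigh : ∀ k, (if n + 1 + k ≤ n then ρ (n + 1 + k) else τ (n + 1 + k - (n + 1))) = τ k :=
    fun k => by rw [if_neg (by omega), Nat.add_sub_cancel_left]
  refine ⟨fun k => if k ≤ n then ρ k else τ (k - (n + 1)), ⟨?_, fun k => ?_⟩, hlow, ?_,
    fun k hk => ?_⟩
  · simpa using hρ.1
  · rcases lt_trichotomy k n with h | rfl | h
    · simpa only [hlow k h.le, hlow (k + 1) h] using hρ.2 k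
    · simpa only [hlow k le_rfl, hhigh 0, hτ0, add_zero] using
        (show A.trans _ _ (if k + 1 + 0 ≤ k then ρ (k + 1 + 0) else τ (k + 1 + 0 - (k + 1))) by
          rw [hhigh 0, hτ0]; simpa using hq)
    · obtain ⟨j, rfl⟩ := Nat.exists_eq_add_of_le h
      have := hτ j
      rw [← hhigh j, ← hhigh (j + 1)] at this
      exact this
  · have h1 := hhigh 0
    simp only [add_zero] at h1
    simp only [h1, hτ0, hlow n le_rfl]
    exact ⟨hq, fun ⟨q', hq', hlt, hnot⟩ => hnot (hmax ⟨hq', hle.trans hlt⟩ hlt)⟩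
  · rcases Nat.lt_or_ge n k with h | h
    · obtain ⟨j, rfl⟩ := Nat.exists_eq_add_of_le h
      have := hacc j hk
      rw [← hhigh j] at this
      exact this
    · simpa only [hlow k h] using hk

theorem goodForPruning_of_directTraceIncl [Finite Q] {A : NBA α Q} {R : Q → Q → Prop}
    (hR : ∀ p q, R p q → A.DirectTraceIncl p q) : A.GoodForPruning R := by
  refine Set.Subset.antisymm (A.language_prune_subset R) ?_
  rintro x ⟨ρ, hρ, hacc⟩
  choose next hagree hprune hnext using
    fun (σ : {σ // A.IsRun x σ}) n =>
      (let ⟨ρ', h, h'⟩ := exists_run_trans_prune hR σ.2 n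
       ⟨⟨ρ', h⟩, h'⟩ : ∃ ρ' : {σ // A.IsRun x σ}, (∀ k ≤ n, ρ'.1 k = σ.1 k) ∧
        (A.prune R).trans (ρ'.1 n) (x n) (ρ'.1 (n + 1)) ∧ ∀ i, σ.1 i ∈ A.acc → ρ'.1 i ∈ A.acc)
  let seq : ℕ → {σ // A.IsRun x σ} := fun n =>
    Nat.rec ⟨ρ, hρ⟩ (fun n σ => next σ n) n
  have hseq : ∀ n, ∀ i, ρ i ∈ A.acc → (seq n).1 i ∈ A.acc := by
    intro n
    induction n with
    | zero => exact fun i hi => hi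
    | succ n ih => exact fun i hi => hnext (seq n) n i (ih i hi)
  -- The runs `seq n` converge to their diagonal, as `seq n` and `seq (n + 1)` agree up to `n`.
  refine ⟨fun n => (seq n).1 n, ⟨hρ.1, fun n => ?_⟩, isAccepting_of_frequently fun n => ?_⟩
  · have h := hprune (seq n) n
    rw [hagree (seq n) n n le_rfl] at h
    exact h
  · obtain ⟨i, hi, hi'⟩ := hacc.frequently n
    exact ⟨i, hi, hseq i i hi'⟩

/-! ### Delayed simulation is not good for pruning -/

/-- The automaton with states `q = false` (initial) and `f = true` (accepting) over the letters
`a = true` and `b = false`, with the transitions `q -a-> q`, `q -b-> q`, `q -a-> f`, `f -a-> f`. -/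
def pruningCounterexample : NBA Bool Bool where
  init := false
  trans p a q := (a = true ∧ (p = true → q = true)) ∨ (a = false ∧ p = false ∧ q = false)
  acc := {true}

/-- Duplicator, on `q`, moves to `f` at once, which settles the pending obligation. -/
lemma pruningCounterexample_sim (κ : BufferKind) :
    pruningCounterexample.sim κ .delayed true false := by
  have hresp : ∀ h : List (Bool × Bool),
      Strategy.response (fun _ => [true]) h = List.replicate h.length true := by
    intro h
    induction h using List.reverseRecOn with
    | nil => simp [Strategy.response]
    | append_singleton h m ih =>
      rw [Strategy.response_concat, ih, List.length_append, List.length_singleton,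
        List.replicate_succ']
  have htrue : ∀ (x : List Bool) (l : List Bool),
      (pruningCounterexample.startAt true).IsPath true x l → ∀ a ∈ x, a = true := by
    intro x
    induction x with
    | nil => simp
    | cons a x ih =>
      rintro (_ | ⟨q, l⟩) hp
      · exact hp.elim
      · obtain ⟨ht, hp⟩ := hp
        obtain ⟨rfl, hq⟩ : a = true ∧ q = true := by
          simpa [startAt, pruningCounterexample] using ht
        subst hq
        simpa using ih l hp
  refine ⟨fun _ => [true], fun h a q hp => ?_, fun x ρ hρ => ?_⟩
  · have ha : a = true := htrue _ _ hp a (by simp)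
    have hbuf : Strategy.buffer (fun _ : List (Bool × Bool) => [true]) h a = [a] := by
      simp [Strategy.buffer, hresp]
    rw [hbuf, ha]
    refine ⟨?_, ?_, trivial⟩
    · cases κ with
      | continuous => exact le_rfl
      | lookAhead => exact Or.inr rfl
    · exact Or.inl ⟨rfl, fun _ => rfl⟩
  · refine ⟨consSeq false fun _ => true, ⟨rfl, fun i => ⟨i + 1, ?_⟩⟩,
      fun i _ => ⟨i + 1, by omega, rfl⟩⟩
    rw [hresp, length_moves, List.getElem?_replicate, if_pos (by omega)]
    rfl

/-- The state `q` has a run on the word `b, b, …`, but `f` has none. -/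
lemma pruningCounterexample_not_generatedPreorder (κ : BufferKind) :
    ¬ generatedPreorder (pruningCounterexample.sim κ .delayed) false true := by
  intro h
  obtain ⟨Φ, -⟩ := delayedContinuousIncl_of_generatedPreorder
    (fun _ _ => delayedContinuousIncl_of_sim) h fun _ => false
  obtain ⟨σ, hσ0, hσ⟩ := Φ ⟨fun _ => false, rfl, fun _ => Or.inr ⟨rfl, rfl, rfl⟩⟩
  have h0 := hσ 0
  rw [hσ0] at h0
  simp [startAt, pruningCounterexample] at h0

lemma pruningCounterexample_not_goodForPruning (κ : BufferKind) :
    ¬ pruningCounterexample.GoodForPruning (pruningCounterexample.sim κ .delayed) := by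
  intro hgood
  have hmem : (fun _ => true) ∈ pruningCounterexample.language :=
    ⟨consSeq false fun _ => true,
      consSeq_mem_runs (A := pruningCounterexample) (q := true) (Or.inl ⟨rfl, fun _ => rfl⟩)
        ⟨rfl, fun _ => Or.inl ⟨rfl, fun _ => rfl⟩⟩,
      true, rfl, fun n => ⟨n + 1, by omega, rfl⟩⟩
  rw [← hgood] at hmem
  obtain ⟨ρ, ⟨h0, hs⟩, f, rfl, hf⟩ := hmem
  have hfalse : ∀ i, ρ i = false := by
    intro i
    induction i with
    | zero => exact h0
    | succ i ih =>
      by_contra hne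
      obtain ⟨-, hnot⟩ := hs i
      rw [ih, Bool.eq_true_of_not_eq_false hne] at hnot
      exact hnot ⟨false, Or.inl ⟨rfl, fun h => h⟩,
        Relation.ReflTransGen.single (pruningCounterexample_sim κ),
        pruningCounterexample_not_generatedPreorder κ⟩
  obtain ⟨i, -, hi⟩ := hf 0
  exact Bool.false_ne_true ((hfalse i).symm.trans hi)

/-! ### Quotients by buffered simulation -/

/-- Only the continuous map induced by a winning strategy matters here, so the kind of buffer and
the winning condition play no role: direct simulation is delayed simulation with immediate
answers. -/
theorem goodForQuotienting_sim [Finite Q] {A : NBA α Q} (hA : A.NoDeadEnds) (κ : BufferKind)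
    (ω : WinCond) : A.GoodForQuotienting (A.sim κ ω) := by
  let _ : TopologicalSpace Q := ⊥
  have : DiscreteTopology Q := ⟨rfl⟩
  exact goodForQuotienting_of_delayedContinuousIncl hA fun _ _ => delayedContinuousIncl_of_sim

end NBA

theorem mainTheorem10 :
    -- delayed simulations are good for quotienting
    (∀ (κ : NBA.BufferKind) (α : Type u) (Q : Type v) [Finite Q] (A : NBA α Q), A.NoDeadEnds →
      A.GoodForQuotienting (A.sim κ .delayed)) ∧
    -- delayed simulations are not good for pruning
    (∀ κ : NBA.BufferKind, ∃ (α Q : Type) (_ : Finite α) (_ : Finite Q) (A : NBA α Q),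
      A.NoDeadEnds ∧ ¬ A.GoodForPruning (A.sim κ .delayed)) ∧
    -- direct simulations are good for quotienting
    (∀ (κ : NBA.BufferKind) (α : Type u) (Q : Type v) [Finite Q] (A : NBA α Q), A.NoDeadEnds →
      A.GoodForQuotienting (A.sim κ .direct)) ∧
    -- direct simulations are good for pruning
    (∀ (κ : NBA.BufferKind) (α : Type u) (Q : Type v) [Finite Q] (A : NBA α Q),
      A.GoodForPruning (A.sim κ .direct)) :=

  ⟨fun κ _ _ _ _ hA => NBA.goodForQuotienting_sim hA κ .delayed,
    fun κ => ⟨Bool, Bool, inferInstance, inferInstance, NBA.pruningCounterexample,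
      fun _ => ⟨true, true, Or.inl ⟨rfl, fun _ => rfl⟩⟩,
      NBA.pruningCounterexample_not_goodForPruning κ⟩,
    fun κ _ _ _ _ hA => NBA.goodForQuotienting_sim hA κ .direct,
    fun _ _ _ _ _ => NBA.goodForPruning_of_directTraceIncl fun _ _ => NBA.directTraceIncl_of_sim⟩
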